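/- Fix $\beta\in(0,1/2)$ and $\omega\in\mathbb R\setminus\{0\}$. For $k\ge 1$ let $t_k:=k^{-\beta}$, $A_k:=(t_{k+1},t_k]$ and $a_k:=t_k-t_{k+1}$. Let $F:[0,1]\to[0,1]$ be the associated $\alpha$-Farey map, $$F(x):=\begin{cases}(1-x)/a_1,& x\in A_1,\\ a_{k-1}(x-t_{k+1})/a_k+t_k,& x\in A_k,\ k\ge 2,\\ 0,& x=0,\end{cases}$$ let $\mu$ be the measure on $(0,1]$ with density $\sum_{k\ge1}\frac{t_k}{a_k}1_{A_k}$ with respect to Lebesgue measure, let $\Phi(x):=\mu([x,1])$ for $x\in(0,1]$ (a bijection from $(0,1]$ onto $[0,\infty)$), and let $T_\beta:=\Phi\circ F\circ\Phi^{-1}$ be the conjugated map of the half-line (the value at the single point $0=\Phi(1)$, where $F(1)=0$ and $\Phi(0)=\infty$, is immaterial). Let $f(x):=e^{2\pi i\omega x}$. Then, for Lebesgue-a.e. $x\in\mathbb R^+$, $$\lim_{n\to\infty}\frac1n\sum_{i=0}^{n-1}f\bigl(T_\beta^i(x)\bigr)=0 .$$ -/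

import Mathlib

open MeasureTheory Set Filter Topology

namespace AlphaFarey

noncomputable section

/- Throughout, `t : ℕ → ℝ` stands for a sequence `(t_k)` indexed by `k ≥ 1`;
the value `t 0` is never used. -/

/-- The partition element `A_k = (t_{k+1}, t_k]`, for `k ≥ 1`. -/
def cell (t : ℕ → ℝ) (k : ℕ) : Set ℝ := Ioc (t (k + 1)) (t k)

/-- The length `a_k = t_k - t_{k+1}` of the partition element `A_k`, for `k ≥ 1`. -/
def len (t : ℕ → ℝ) (k : ℕ) : ℝ := t k - t (k + 1)

/-- The index `k ≥ 1` of the partition element `A_k` that contains `x`, and `0` if there is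
none, that is, if `x ∉ (0, 1]`. -/
def index (t : ℕ → ℝ) (x : ℝ) : ℕ := sInf {k : ℕ | 1 ≤ k ∧ x ∈ cell t k}

/-- The `α`-Farey map `F_α : [0, 1] → [0, 1]` (extended by `0` outside `[0, 1]`). -/
def fareyMap (t : ℕ → ℝ) (x : ℝ) : ℝ :=
  if index t x = 0 then 0
  else if index t x = 1 then (1 - x) / len t 1
  else len t (index t x - 1) * (x - t (index t x + 1)) / len t (index t x) + t (index t x)

/-- The invariant density `h_α = ∑_{k ≥ 1} (t_k / a_k) 1_{A_k}`. -/
def density (t : ℕ → ℝ) (x : ℝ) : ENNReal :=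
  ∑' k : ℕ, (cell t (k + 1)).indicator
    (fun _ => ENNReal.ofReal (t (k + 1) / len t (k + 1))) x

/-- The measure `μ_α` with density `h_α` with respect to Lebesgue measure. -/
def invMeasure (t : ℕ → ℝ) : Measure ℝ := volume.withDensity (density t)

/-- The map `Φ(x) = μ_α([x, 1])`. It is used on `(0, 1]`, where it is finite; it is a bijection
of `(0, 1]` onto `[0, ∞)` when `μ_α` is infinite. -/
def conj (t : ℕ → ℝ) (x : ℝ) : ℝ := (invMeasure t (Icc x 1)).toReal

/-- The inverse `Φ⁻¹ : [0, ∞) → (0, 1]`. -/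
def conjInv (t : ℕ → ℝ) : ℝ → ℝ := Function.invFunOn (conj t) (Ioc 0 1)

/-- The conjugate `Φ ∘ F_α ∘ Φ⁻¹` of the `α`-Farey map on the positive half-line. (At the single
point `0 = Φ(1)`, where `F_α(1) = 0` and `Φ(0) = ∞`, its value is a convention.) -/
def halfLineMap (t : ℕ → ℝ) : ℝ → ℝ := conj t ∘ fareyMap t ∘ conjInv t

/-- The sequence `t_k = k^{-β}`, for `k ≥ 1`. -/
def powerSeq (β : ℝ) (k : ℕ) : ℝ := (k : ℝ) ^ (-β)

/-- The map `T_β`. -/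
def T (β : ℝ) : ℝ → ℝ := halfLineMap (powerSeq β)

end

end AlphaFarey

namespace AlphaFarey

noncomputable section

/-! Under Φ the cells become consecutive intervals ("levels") of lengths t_1, t_2, …, stacked along
the half-line. The map slides each level affinely onto the one below; on the ground level [0,1) it
is Φ itself, so a point of A_k jumps to the k-th level and is back after k steps. The first-return
map is the Lüroth map, which preserves Lebesgue measure and has independent digits.

During one excursion the positions have increments that are monotone and bounded below by a t_j, so
a Kusmin–Landau estimate (`norm_sum_exp_le`) bounds every partial sum of the character by C/q, where
q is the starting point (`exists_norm_birkhoffSum_le`). Let q_i be the Lüroth orbit. Borel–Cantelli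
gives, almost surely and eventually, q_i ≥ (i+1)^{-p} for p > 1, and some digit among the first N
larger than N^γ for γ < 1/β. Hence the Birkhoff sum up to the (N+1)-st return is O(N^{p+1}), while
the N-th return takes time at least N^γ. Since β < 1/2, one may take p + 1 < γ. Finally,
`ae_Ioi_of_ae_Ico` carries the result from the ground level to the half-line. -/

/-- The sequence `(t_k)_{k ≥ 1}` decreases strictly from `t_1 = 1` to `0`, so that the cells
partition `(0, 1]`. -/
structure IsPartitionSeq (t : ℕ → ℝ) : Prop where
  one : t 1 = 1
  strictAnti : StrictAnti fun k => t (k + 1)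
  tendsto : Tendsto t atTop (𝓝 0)

/-- The point of the half-line at relative position `q ∈ [0, 1)` in the image of `A_{k+1}`
under `Φ`. -/
def levelPoint (t : ℕ → ℝ) (k : ℕ) (q : ℝ) : ℝ := ∑ i ∈ Finset.range k, t (i + 1) + q * t (k + 1)

/-- The `α`-Lüroth map, which sends each cell affinely onto `[0, 1)`, reversing orientation. -/
def lurothMap (t : ℕ → ℝ) (x : ℝ) : ℝ := (t (index t x) - x) / len t (index t x)

/-! ### Cells, levels and the action of the map on them -/

namespace IsPartitionSeq

theorem pos {t : ℕ → ℝ} (ht : IsPartitionSeq t) (k : ℕ) : 0 < t (k + 1) := by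
  have h1 : t (k + 1 + 1) < t (k + 1) := ht.strictAnti (Nat.lt_succ_self k)
  have h2 : Tendsto (fun k => t (k + 1)) atTop (𝓝 0) := (tendsto_add_atTop_iff_nat 1).2 ht.tendsto
  have h3 := ht.strictAnti.antitone.le_of_tendsto h2 (k + 1)
  beta_reduce at h3
  linarith

theorem le_one {t : ℕ → ℝ} (ht : IsPartitionSeq t) (k : ℕ) : t (k + 1) ≤ 1 := by
  have := ht.strictAnti.antitone (Nat.zero_le k)
  simpa [ht.one] using this

theorem len_pos {t : ℕ → ℝ} (ht : IsPartitionSeq t) (k : ℕ) : 0 < len t (k + 1) :=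
  sub_pos.2 (ht.strictAnti (Nat.lt_succ_self k))

theorem cell_unique {t : ℕ → ℝ} (ht : IsPartitionSeq t)
    {x : ℝ} {k l : ℕ} (hk : x ∈ cell t (k + 1)) (hl : x ∈ cell t (l + 1)) :
    k = l := by
  by_contra hne
  wlog h : k < l generalizing k l
  · exact this hl hk (Ne.symm hne) (by omega)
  have h1 : t (l + 1) ≤ t (k + 1 + 1) := ht.strictAnti.antitone (show k + 1 ≤ l by omega)
  exact absurd hk.1 (not_lt.2 (hl.2.trans h1))

theorem index_eq {t : ℕ → ℝ} (ht : IsPartitionSeq t)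
    {x : ℝ} {k : ℕ} (hk : x ∈ cell t (k + 1)) : index t x = k + 1 := by
  have hset : {k : ℕ | 1 ≤ k ∧ x ∈ cell t k} = {k + 1} := by
    ext l
    simp only [mem_ofPred_eq, mem_singleton_iff]
    constructor
    · rintro ⟨h1, h2⟩
      obtain ⟨l, rfl⟩ := Nat.exists_eq_succ_of_ne_zero (by omega : l ≠ 0)
      rw [ht.cell_unique hk h2]
    · rintro rfl
      exact ⟨by omega, hk⟩
  rw [index, hset, csInf_singleton]

theorem exists_mem_cell {t : ℕ → ℝ} (ht : IsPartitionSeq t)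
    {x : ℝ} (hx : x ∈ Ioc (0 : ℝ) 1) : ∃ k, x ∈ cell t (k + 1) := by
  classical
  have hex : ∃ k, t (k + 1 + 1) < x :=
    (((tendsto_add_atTop_iff_nat 2).2 ht.tendsto).eventually (gt_mem_nhds hx.1)).exists
  refine ⟨Nat.find hex, Nat.find_spec hex, ?_⟩
  rcases h : Nat.find hex with _ | k
  · rw [ht.one]; exact hx.2
  · exact not_lt.1 (Nat.find_min hex (show k < Nat.find hex by omega))

theorem cell_subset {t : ℕ → ℝ} (ht : IsPartitionSeq t)
    (k : ℕ) : cell t (k + 1) ⊆ Ioc 0 1 := fun _ hx =>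
  ⟨(ht.pos (k + 1)).trans hx.1, hx.2.trans (ht.le_one k)⟩

theorem lurothMap_eq {t : ℕ → ℝ} (ht : IsPartitionSeq t) {x : ℝ} {k : ℕ} (hk : x ∈ cell t (k + 1)) :
    lurothMap t x = (t (k + 1) - x) / len t (k + 1) := by
  rw [lurothMap, ht.index_eq hk]

theorem lurothMap_mem {t : ℕ → ℝ} (ht : IsPartitionSeq t)
    {x : ℝ} (hx : x ∈ Ioc (0 : ℝ) 1) : lurothMap t x ∈ Ico (0 : ℝ) 1 := by
  obtain ⟨k, hk⟩ := ht.exists_mem_cell hx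
  rw [ht.lurothMap_eq hk]
  have := ht.len_pos k
  refine ⟨div_nonneg (sub_nonneg.2 hk.2) this.le, (div_lt_one this).2 ?_⟩
  have := hk.1
  simp only [len]; linarith

theorem volume_cell_inter_Icc_of_lt {t : ℕ → ℝ} (ht : IsPartitionSeq t)
    {x : ℝ} {k j : ℕ} (hk : x ∈ cell t (k + 1)) (hj : j < k) :
    volume (cell t (j + 1) ∩ Icc x 1) = ENNReal.ofReal (len t (j + 1)) := by
  have h : cell t (j + 1) ∩ Icc x 1 = cell t (j + 1) := by
    refine inter_eq_left.2 fun y hy => ⟨?_, (ht.cell_subset j hy).2⟩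
    have h1 : t (k + 1) ≤ t (j + 1 + 1) := ht.strictAnti.antitone (show j + 1 ≤ k by omega)
    linarith [hy.1, hk.2]
  rw [h, cell, Real.volume_Ioc, len]

theorem volume_cell_inter_Icc_self {t : ℕ → ℝ} (ht : IsPartitionSeq t)
    {x : ℝ} {k : ℕ} (hk : x ∈ cell t (k + 1)) :
    volume (cell t (k + 1) ∩ Icc x 1) = ENNReal.ofReal (t (k + 1) - x) := by
  have h : cell t (k + 1) ∩ Icc x 1 = Icc x (t (k + 1)) := by
    ext y
    constructor
    · rintro ⟨h1, h2⟩
      exact ⟨h2.1, h1.2⟩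
    · rintro ⟨h1, h2⟩
      exact ⟨⟨hk.1.trans_le h1, h2⟩, h1, h2.trans (ht.le_one k)⟩
  rw [h, Real.volume_Icc]

theorem volume_cell_inter_Icc_of_gt {t : ℕ → ℝ} (ht : IsPartitionSeq t)
    {x : ℝ} {k j : ℕ} (hk : x ∈ cell t (k + 1)) (hj : k < j) :
    volume (cell t (j + 1) ∩ Icc x 1) = 0 := by
  have h : cell t (j + 1) ∩ Icc x 1 = ∅ := by
    ext y
    simp only [mem_inter_iff, mem_empty_iff_false, iff_false, not_and]
    intro h1 h2
    have h3 : t (j + 1) ≤ t (k + 1 + 1) := ht.strictAnti.antitone (show k + 1 ≤ j by omega)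
    linarith [h1.2, h2.1, hk.1]
  rw [h, measure_empty]

theorem invMeasure_apply {t : ℕ → ℝ} {s : Set ℝ} (hs : MeasurableSet s) :
    invMeasure t s = ∑' k : ℕ,
      ENNReal.ofReal (t (k + 1) / len t (k + 1)) * volume (cell t (k + 1) ∩ s) := by
  rw [invMeasure, withDensity_apply _ hs]
  simp only [density]
  rw [lintegral_tsum fun k =>
    (measurable_const.indicator (show MeasurableSet (cell t (k + 1)) from
      measurableSet_Ioc)).aemeasurable]
  refine tsum_congr fun k => ?_
  have hc : MeasurableSet (cell t (k + 1)) := measurableSet_Ioc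
  rw [lintegral_indicator_const hc, Measure.restrict_apply hc]

/-- The density is t_j / a_j on A_j, so each full cell to the right of `x` has mass t_j, and the
cell of `x` contributes in proportion to the part lying right of `x`. -/
theorem conj_eq {t : ℕ → ℝ} (ht : IsPartitionSeq t) {x : ℝ} {k : ℕ} (hk : x ∈ cell t (k + 1)) :
    conj t x = levelPoint t k ((t (k + 1) - x) / len t (k + 1)) := by
  have h0 : ∀ j, 0 ≤ t (j + 1) / len t (j + 1) := fun j =>
    div_nonneg (ht.pos j).le (ht.len_pos j).le
  have hlast : 0 ≤ (t (k + 1) - x) / len t (k + 1) * t (k + 1) :=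
    mul_nonneg (div_nonneg (sub_nonneg.2 hk.2) (ht.len_pos k).le) (ht.pos k).le
  have key : invMeasure t (Icc x 1) = ENNReal.ofReal
      (levelPoint t k ((t (k + 1) - x) / len t (k + 1))) := by
    rw [invMeasure_apply measurableSet_Icc, tsum_eq_sum (s := Finset.range (k + 1)),
      Finset.sum_range_succ, levelPoint, ENNReal.ofReal_add
        (Finset.sum_nonneg fun i _ => (ht.pos i).le) hlast,
      ENNReal.ofReal_sum_of_nonneg fun i _ => (ht.pos i).le]
    · congr 1
      · refine Finset.sum_congr rfl fun j hj => ?_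
        rw [ht.volume_cell_inter_Icc_of_lt hk (Finset.mem_range.1 hj),
          ← ENNReal.ofReal_mul (h0 j), div_mul_cancel₀ _ (ht.len_pos j).ne']
      · rw [ht.volume_cell_inter_Icc_self hk, ← ENNReal.ofReal_mul (h0 k)]
        congr 1
        ring
    · intro j hj
      rw [ht.volume_cell_inter_Icc_of_gt hk (by simpa using hj), mul_zero]
  rw [conj, key, ENNReal.toReal_ofReal]
  exact add_nonneg (Finset.sum_nonneg fun i _ => (ht.pos i).le) hlast

theorem conj_eq_lurothMap {t : ℕ → ℝ} (ht : IsPartitionSeq t)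
    {x : ℝ} {k : ℕ} (hk : x ∈ cell t (k + 1)) :
    conj t x = levelPoint t k (lurothMap t x) := by
  rw [ht.conj_eq hk, ht.lurothMap_eq hk]

theorem levelPoint_zero {t : ℕ → ℝ} (ht : IsPartitionSeq t) (q : ℝ) : levelPoint t 0 q = q := by
  simp [levelPoint, ht.one]

theorem levelPoint_succ_zero {t : ℕ → ℝ} (k : ℕ) : levelPoint t (k + 1) 0 = levelPoint t k 1 := by
  simp [levelPoint, Finset.sum_range_succ]

theorem levelPoint_strictMono {t : ℕ → ℝ} (ht : IsPartitionSeq t)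
    (k : ℕ) : StrictMono (levelPoint t k) := fun _ _ h =>
  add_lt_add_right (mul_lt_mul_of_pos_right h (ht.pos k)) _

theorem levelPoint_lt {t : ℕ → ℝ} (ht : IsPartitionSeq t)
    {k l : ℕ} (h : k < l) {p q : ℝ} (hp : p < 1) (hq : 0 ≤ q) :
    levelPoint t k p < levelPoint t l q := by
  refine (ht.levelPoint_strictMono k hp).trans_le ?_
  refine le_trans ?_ ((ht.levelPoint_strictMono l).monotone hq)
  rw [← levelPoint_succ_zero]
  simp only [levelPoint, zero_mul, add_zero]
  exact Finset.sum_le_sum_of_subset_of_nonneg (Finset.range_mono h) fun i _ _ => (ht.pos i).le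

/-- Levels are disjoint and each is parametrized injectively. Injectivity alone makes `conjInv` a
left inverse of `conj`, which is all that the computation of the map needs. -/
theorem conj_injOn {t : ℕ → ℝ} (ht : IsPartitionSeq t) : InjOn (conj t) (Ioc 0 1) := by
  intro x hx y hy hxy
  obtain ⟨k, hk⟩ := ht.exists_mem_cell hx
  obtain ⟨l, hl⟩ := ht.exists_mem_cell hy
  rw [ht.conj_eq_lurothMap hk, ht.conj_eq_lurothMap hl] at hxy
  have hx' := ht.lurothMap_mem hx
  have hy' := ht.lurothMap_mem hy
  rcases lt_trichotomy k l with h | rfl | h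
  · exact absurd hxy (ht.levelPoint_lt h hx'.2 hy'.1).ne
  · have := (ht.levelPoint_strictMono k).injective hxy
    rw [ht.lurothMap_eq hk, ht.lurothMap_eq hl, div_left_inj' (ht.len_pos k).ne'] at this
    linarith
  · exact absurd hxy (ht.levelPoint_lt h hy'.2 hx'.1).ne'

theorem halfLineMap_conj {t : ℕ → ℝ} (ht : IsPartitionSeq t) {x : ℝ} (hx : x ∈ Ioc (0 : ℝ) 1) :
    halfLineMap t (conj t x) = conj t (fareyMap t x) := by
  simp only [halfLineMap, Function.comp_apply, conjInv]
  rw [ht.conj_injOn.leftInvOn_invFunOn hx]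

theorem sub_mul_len_mem_cell {t : ℕ → ℝ} (ht : IsPartitionSeq t)
    (k : ℕ) {q : ℝ} (hq : q ∈ Ico (0 : ℝ) 1) :
    t (k + 1) - q * len t (k + 1) ∈ cell t (k + 1) := by
  have h := ht.len_pos k
  constructor
  · have : q * len t (k + 1) < 1 * len t (k + 1) := mul_lt_mul_of_pos_right hq.2 h
    simp only [len] at this ⊢; linarith
  · have := mul_nonneg hq.1 h.le
    linarith

theorem conj_sub_mul_len {t : ℕ → ℝ} (ht : IsPartitionSeq t)
    (k : ℕ) {q : ℝ} (hq : q ∈ Ico (0 : ℝ) 1) :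
    conj t (t (k + 1) - q * len t (k + 1)) = levelPoint t k q := by
  rw [ht.conj_eq (ht.sub_mul_len_mem_cell k hq), sub_sub_cancel,
    mul_div_cancel_right₀ _ (ht.len_pos k).ne']

/-- Above the ground level, `T` moves down one level and preserves the relative position. -/
theorem halfLineMap_levelPoint_succ {t : ℕ → ℝ} (ht : IsPartitionSeq t)
    (k : ℕ) {q : ℝ} (hq : q ∈ Ico (0 : ℝ) 1) :
    halfLineMap t (levelPoint t (k + 1) q) = levelPoint t k q := by
  have hc := ht.sub_mul_len_mem_cell (k + 1) hq
  rw [← ht.conj_sub_mul_len (k + 1) hq, ht.halfLineMap_conj (ht.cell_subset _ hc),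
    ← ht.conj_sub_mul_len k hq, fareyMap, ht.index_eq hc, if_neg (by omega), if_neg (by omega)]
  congr 1
  have h := (ht.len_pos (k + 1)).ne'
  rw [Nat.add_sub_cancel, div_add' _ _ _ h, div_eq_iff h]
  simp only [len]
  ring

/-- On the ground level `[0, 1)`, `T` jumps to the level given by the cell. -/
theorem halfLineMap_of_mem_cell {t : ℕ → ℝ} (ht : IsPartitionSeq t)
    {q : ℝ} {k : ℕ} (hq : q < 1) (hk : q ∈ cell t (k + 1)) :
    halfLineMap t q = levelPoint t k (lurothMap t q) := by
  have hq' : q ∈ Ico (0 : ℝ) 1 := ⟨(ht.cell_subset k hk).1.le, hq⟩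
  -- Here Φ⁻¹(q) = 1 - q a_1 lies in A_1, and F sends it back to q; so the map coincides with Φ at
  -- q.
  have hc := ht.sub_mul_len_mem_cell 0 hq'
  rw [← ht.conj_eq_lurothMap hk]
  conv_lhs => rw [← ht.levelPoint_zero q, ← ht.conj_sub_mul_len 0 hq',
    ht.halfLineMap_conj (ht.cell_subset _ hc)]
  congr 1
  rw [fareyMap, ht.index_eq hc, if_neg (by omega), if_pos rfl, zero_add, ht.one, sub_sub_cancel,
    mul_div_cancel_right₀ _ (ht.len_pos 0).ne']

theorem iterate_halfLineMap_levelPoint {t : ℕ → ℝ} (ht : IsPartitionSeq t)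
    (k r : ℕ) {q : ℝ} (hq : q ∈ Ico (0 : ℝ) 1) :
    (halfLineMap t)^[r] (levelPoint t (k + r) q) = levelPoint t k q := by
  induction r with
  | zero => rfl
  | succ r ih => rw [Function.iterate_succ_apply, ← add_assoc,
      ht.halfLineMap_levelPoint_succ _ hq, ih]

theorem iterate_succ_halfLineMap {t : ℕ → ℝ} (ht : IsPartitionSeq t)
    {q : ℝ} {k r : ℕ} (hq : q < 1) (hk : q ∈ cell t (k + 1))
    (hr : r ≤ k) : (halfLineMap t)^[r + 1] q = levelPoint t (k - r) (lurothMap t q) := by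
  have h := ht.iterate_halfLineMap_levelPoint (k - r) r (ht.lurothMap_mem (ht.cell_subset k hk))
  rw [Nat.sub_add_cancel hr] at h
  rw [Function.iterate_succ_apply, ht.halfLineMap_of_mem_cell hq hk, h]

/-- The return map to the ground level is the Lüroth map. -/
theorem iterate_index_halfLineMap {t : ℕ → ℝ} (ht : IsPartitionSeq t)
    {q : ℝ} (hq : q ∈ Ioo (0 : ℝ) 1) :
    (halfLineMap t)^[index t q] q = lurothMap t q := by
  obtain ⟨k, hk⟩ := ht.exists_mem_cell (Ioo_subset_Ioc_self hq)
  rw [ht.index_eq hk, ht.iterate_succ_halfLineMap hq.2 hk le_rfl, Nat.sub_self,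
    ht.levelPoint_zero]

end IsPartitionSeq

/-! ### A Kusmin–Landau estimate -/

theorem two_div_pi_mul_abs_le_norm_exp_sub_one {θ : ℝ} (hθ : |θ| ≤ Real.pi) :
    2 / Real.pi * |θ| ≤ ‖Complex.exp (Complex.I * θ) - 1‖ := by
  have h : 2 / Real.pi * (|θ| / 2) ≤ Real.sin (|θ| / 2) :=
    Real.mul_le_sin (by positivity) (by linarith)
  rw [Complex.norm_exp_I_mul_ofReal_sub_one, Real.norm_eq_abs, abs_mul, abs_two]
  have h2 : |Real.sin (θ / 2)| = |Real.sin (|θ| / 2)| := by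
    rcases abs_cases θ with ⟨h, _⟩ | ⟨h, _⟩ <;> rw [h]
    rw [neg_div, Real.sin_neg, abs_neg]
  rw [h2]
  have h3 := h.trans (le_abs_self _)
  have h4 : 2 / Real.pi * |θ| = 2 * (2 / Real.pi * (|θ| / 2)) := by ring
  rw [h4]
  linarith

theorem norm_exp_I_sub_exp_I_le (a b : ℝ) :
    ‖Complex.exp (Complex.I * a) - Complex.exp (Complex.I * b)‖ ≤ |a - b| := by
  have h : Complex.exp (Complex.I * a) - Complex.exp (Complex.I * b) =
      Complex.exp (Complex.I * b) * (Complex.exp (Complex.I * (a - b : ℝ)) - 1) := by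
    rw [mul_sub, ← Complex.exp_add, mul_one]
    congr 2
    push_cast
    ring
  rw [h, norm_mul, Complex.norm_exp_I_mul_ofReal, one_mul]
  exact Real.norm_exp_I_mul_ofReal_sub_one_le

theorem norm_inv_exp_sub_one_le {θ : ℝ} (h0 : θ ≠ 0) (hθ : |θ| ≤ Real.pi) :
    ‖(Complex.exp (Complex.I * θ) - 1)⁻¹‖ ≤ Real.pi / 2 * |θ|⁻¹ := by
  have h1 := two_div_pi_mul_abs_le_norm_exp_sub_one hθ
  have h2 : 0 < |θ| := abs_pos.2 h0
  have h3 := Real.pi_pos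
  rw [norm_inv]
  calc _ ≤ (2 / Real.pi * |θ|)⁻¹ := inv_anti₀ (by positivity) h1
    _ = _ := by rw [mul_inv, inv_div]

theorem exp_I_sub_one_ne_zero {θ : ℝ} (h0 : θ ≠ 0) (hθ : |θ| ≤ Real.pi) :
    Complex.exp (Complex.I * θ) - 1 ≠ 0 := by
  have h1 := two_div_pi_mul_abs_le_norm_exp_sub_one hθ
  have h2 : 0 < |θ| := abs_pos.2 h0
  have h3 := Real.pi_pos
  exact norm_pos_iff.1 (lt_of_lt_of_le (by positivity) h1)

/-- The difference of inverses is a difference of exponentials, at most |a|(d - e), times two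
inverses controlled by Jordan's inequality. The bound is written as a difference so that it
telescopes. -/
theorem norm_inv_exp_sub_one_sub_le {a d e : ℝ} (ha : a ≠ 0) (he : 0 < e) (hed : e ≤ d)
    (hd : |a| * d ≤ Real.pi) :
    ‖(Complex.exp (Complex.I * (a * d : ℝ)) - 1)⁻¹ - (Complex.exp (Complex.I * (a * e : ℝ)) - 1)⁻¹‖
      ≤ (Real.pi / 2) ^ 2 * ((|a| * e)⁻¹ - (|a| * d)⁻¹) := by
  have hd0 : 0 < d := he.trans_le hed
  have ha' : 0 < |a| := abs_pos.2 ha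
  have hadeq : |a * d| = |a| * d := by rw [abs_mul, abs_of_pos hd0]
  have haeeq : |a * e| = |a| * e := by rw [abs_mul, abs_of_pos he]
  have had : |a * d| ≤ Real.pi := hadeq ▸ hd
  have hae : |a * e| ≤ Real.pi := haeeq ▸ (mul_le_mul_of_nonneg_left hed ha'.le).trans hd
  have hd1 : a * d ≠ 0 := mul_ne_zero ha hd0.ne'
  have he1 : a * e ≠ 0 := mul_ne_zero ha he.ne'
  have n1 := exp_I_sub_one_ne_zero hd1 had
  have n2 := exp_I_sub_one_ne_zero he1 hae
  have i1 := norm_inv_exp_sub_one_le hd1 had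
  have i2 := norm_inv_exp_sub_one_le he1 hae
  have i3 := norm_exp_I_sub_exp_I_le (a * e) (a * d)
  rw [inv_sub_inv n1 n2, div_eq_mul_inv, mul_inv, norm_mul, norm_mul, sub_sub_sub_cancel_right]
  have h3 : |a * e - a * d| = |a| * (d - e) := by
    rw [← mul_sub, abs_mul, abs_sub_comm, abs_of_nonneg (sub_nonneg.2 hed)]
  have hpi := Real.pi_pos
  calc _ ≤ |a * e - a * d| * (Real.pi / 2 * |a * d|⁻¹ * (Real.pi / 2 * |a * e|⁻¹)) := by
        gcongr
    _ = _ := by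
        rw [h3, hadeq, haeeq]
        field_simp

/-- An exponential sum whose phase has positive, decreasing increments is bounded by the
reciprocal of the last increment (a form of the Kusmin–Landau inequality). -/
theorem norm_sum_exp_le {a : ℝ} (ha : a ≠ 0) {x : ℕ → ℝ} (hpos : ∀ j, 0 < x (j + 1) - x j)
    (hanti : Antitone fun j => x (j + 1) - x j) {m n : ℕ} (hmn : m ≤ n)
    (hpi : |a| * (x (m + 1) - x m) ≤ Real.pi) :
    ‖∑ j ∈ Finset.Ico m (n + 1), Complex.exp (Complex.I * (a * x j : ℝ))‖ ≤
      6 / (|a| * (x (n + 1) - x n)) := by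
  set d : ℕ → ℝ := fun j => x (j + 1) - x j with hd
  have ha' : 0 < |a| := abs_pos.2 ha
  have hpi' : ∀ j, m ≤ j → |a| * d j ≤ Real.pi := fun j hj =>
    (mul_le_mul_of_nonneg_left (hanti hj) ha'.le).trans hpi
  have habs : ∀ j, |a * d j| = |a| * d j := fun j => by rw [abs_mul, abs_of_pos (hpos j)]
  have hne : ∀ j, a * d j ≠ 0 := fun j => mul_ne_zero ha (hpos j).ne'
  set w : ℕ → ℂ := fun j => (Complex.exp (Complex.I * (a * d j : ℝ)) - 1)⁻¹ with hw
  set z : ℕ → ℂ := fun j => Complex.exp (Complex.I * (a * x j : ℝ)) with hz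
  have hz1 : ∀ j, ‖z j‖ = 1 := fun j => Complex.norm_exp_I_mul_ofReal _
  have hw1 : ∀ j, m ≤ j → ‖w j‖ ≤ Real.pi / 2 * (|a| * d j)⁻¹ := fun j hj => by
    have := norm_inv_exp_sub_one_le (hne j) ((habs j).trans_le (hpi' j hj))
    rwa [habs] at this
  -- Each term is a discrete derivative times a slowly varying weight, which sets up summation by
  -- parts.
  have hzw : ∀ j, m ≤ j → z j = (z (j + 1) - z j) * w j := fun j hj => by
    have h1 := exp_I_sub_one_ne_zero (hne j) ((habs j).trans_le (hpi' j hj))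
    have h2 : z (j + 1) = z j * Complex.exp (Complex.I * (a * d j : ℝ)) := by
      simp only [hz, hd]
      rw [← Complex.exp_add]
      congr 1
      push_cast
      ring
    rw [h2, eq_comm, hw, ← div_eq_mul_inv, div_eq_iff h1]
    ring
  have main : ∀ n, m ≤ n → ‖∑ j ∈ Finset.Ico m (n + 1), z j - w n * z (n + 1)‖ ≤
      ‖w m‖ + (Real.pi / 2) ^ 2 * ((|a| * d n)⁻¹ - (|a| * d m)⁻¹) := by
    intro n hn
    induction n, hn using Nat.le_induction with
    | base =>
      have h : z m - w m * z (m + 1) = -(w m * z m) := by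
        linear_combination hzw m le_rfl
      simp [h, hz1]
    | succ n hn ih =>
      have h1 := norm_inv_exp_sub_one_sub_le ha (hpos (n + 1)) (hanti (Nat.le_succ n)) (hpi' n hn)
      have h : ∑ j ∈ Finset.Ico m (n + 1 + 1), z j - w (n + 1) * z (n + 1 + 1) =
          (∑ j ∈ Finset.Ico m (n + 1), z j - w n * z (n + 1)) + (w n - w (n + 1)) * z (n + 1) := by
        rw [Finset.sum_Ico_succ_top (by omega)]
        linear_combination hzw (n + 1) (by omega)
      rw [h]
      refine (norm_add_le _ _).trans ?_
      rw [norm_mul, hz1, mul_one]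
      have h2 : ‖w n - w (n + 1)‖ ≤ _ := h1
      linarith
  have h1 : ‖∑ j ∈ Finset.Ico m (n + 1), z j‖ ≤
      ‖∑ j ∈ Finset.Ico m (n + 1), z j - w n * z (n + 1)‖ + ‖w n‖ := by
    have := norm_add_le (∑ j ∈ Finset.Ico m (n + 1), z j - w n * z (n + 1)) (w n * z (n + 1))
    rwa [sub_add_cancel, norm_mul, hz1, mul_one] at this
  have h2 := main n hmn
  have h3 := hw1 m le_rfl
  have h4 := hw1 n hmn
  have h5 : (|a| * d m)⁻¹ ≤ (|a| * d n)⁻¹ :=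
    inv_anti₀ (mul_pos ha' (hpos n)) (mul_le_mul_of_nonneg_left (hanti hmn) ha'.le)
  have h6 : 0 < (|a| * d m)⁻¹ := inv_pos.2 (mul_pos ha' (hpos m))
  have h7 : Real.pi / 2 * (|a| * d m)⁻¹ ≤ Real.pi / 2 * (|a| * d n)⁻¹ := by gcongr
  -- The two boundary weights cost π/2 each and the telescoped variation costs (π/2)², all measured
  -- in units of the largest reciprocal, the one at `n`.
  have h8 : Real.pi + (Real.pi / 2) ^ 2 ≤ 6 := by nlinarith [Real.pi_lt_d2, Real.pi_pos]
  have h9 : (Real.pi + (Real.pi / 2) ^ 2) * (|a| * d n)⁻¹ ≤ 6 * (|a| * d n)⁻¹ :=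
    mul_le_mul_of_nonneg_right h8 (h6.le.trans h5)
  have h10 : 0 ≤ (Real.pi / 2) ^ 2 * (|a| * d m)⁻¹ := by positivity
  rw [div_eq_mul_inv]
  refine h1.trans ?_
  linarith

/-! ### Exponential sums over one excursion -/

namespace IsPartitionSeq

theorem levelPoint_succ_sub {t : ℕ → ℝ} (j : ℕ) (q : ℝ) :
    levelPoint t (j + 1) q - levelPoint t j q = (1 - q) * t (j + 1) + q * t (j + 2) := by
  simp only [levelPoint, Finset.sum_range_succ]
  ring

/-- Exponential sums along consecutive levels. -/
theorem exists_norm_sum_exp_levelPoint_le {t : ℕ → ℝ} (ht : IsPartitionSeq t) {a : ℝ} (ha : a ≠ 0) :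
    ∃ C : ℝ, 0 < C ∧ ∀ q ∈ Ico (0 : ℝ) 1, ∀ m k : ℕ, m ≤ k →
      ‖∑ j ∈ Finset.Ico m (k + 1), Complex.exp (Complex.I * (a * levelPoint t j q : ℝ))‖ ≤
        C / t (k + 2) := by
  have ha' : 0 < |a| := abs_pos.2 ha
  obtain ⟨J, hJ⟩ : ∃ J : ℕ, |a| * t (J + 1) ≤ Real.pi := by
    have h := ((tendsto_add_atTop_iff_nat 1).2 ht.tendsto).const_mul |a|
    rw [mul_zero] at h
    exact (h.eventually (ge_mem_nhds Real.pi_pos)).exists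
  -- Below level `J` the phase increments may exceed π, so those at most `J` terms are bounded
  -- trivially; the rest fall under `norm_sum_exp_le`.
  refine ⟨J + 6 / |a|, by positivity, fun q hq m k hmk => ?_⟩
  have hq1 : 0 ≤ 1 - q := by linarith [hq.2]
  have hle : ∀ j, t (j + 2) ≤ t (j + 1) := fun j => (ht.strictAnti (Nat.lt_succ_self j)).le
  have hlow : ∀ j, t (j + 2) ≤ levelPoint t (j + 1) q - levelPoint t j q := fun j => by
    rw [levelPoint_succ_sub]; nlinarith [hle j]
  have hup : ∀ j, levelPoint t (j + 1) q - levelPoint t j q ≤ t (j + 1) := fun j => by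
    rw [levelPoint_succ_sub]; nlinarith [hle j, hq.1]
  have hpos : ∀ j, 0 < levelPoint t (j + 1) q - levelPoint t j q := fun j =>
    (ht.pos (j + 1)).trans_le (hlow j)
  -- Each increment lies between t_{j+2} and t_{j+1}, and these ranges are ordered.
  have hanti : Antitone fun j => levelPoint t (j + 1) q - levelPoint t j q :=
    antitone_nat_of_succ_le fun j => (hup (j + 1)).trans (hlow j)
  have htk := ht.pos (k + 1)
  have htk1 := ht.le_one (k + 1)
  have hJle : (J : ℝ) ≤ J / t (k + 2) := le_div_self (Nat.cast_nonneg J) htk htk1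
  have htail : ∀ m, J ≤ m → m ≤ k →
      ‖∑ j ∈ Finset.Ico m (k + 1), Complex.exp (Complex.I * (a * levelPoint t j q : ℝ))‖ ≤
        6 / |a| / t (k + 2) := fun m hm hmk => by
    have hpi : |a| * (levelPoint t (m + 1) q - levelPoint t m q) ≤ Real.pi :=
      (mul_le_mul_of_nonneg_left ((hup m).trans (ht.strictAnti.antitone hm)) ha'.le).trans hJ
    refine (norm_sum_exp_le ha hpos hanti hmk hpi).trans ?_
    rw [div_div]
    have := hlow k
    gcongr
  have hhead : ∀ n, n ≤ J →
      ‖∑ j ∈ Finset.Ico m n, Complex.exp (Complex.I * (a * levelPoint t j q : ℝ))‖ ≤ J := by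
    intro n hn
    refine (norm_sum_le _ _).trans ?_
    simp only [Complex.norm_exp_I_mul_ofReal, Finset.sum_const, Nat.card_Ico, nsmul_eq_mul, mul_one]
    exact_mod_cast (by omega : n - m ≤ J)
  have h6 : 0 ≤ 6 / |a| / t (k + 2) := by positivity
  rw [add_div]
  rcases le_total J m with h | h
  · linarith [htail m h hmk, Nat.cast_nonneg (α := ℝ) J]
  · rcases le_or_gt J k with h' | h'
    · rw [← Finset.sum_Ico_consecutive _ h (by omega : J ≤ k + 1)]
      exact (norm_add_le _ _).trans (add_le_add ((hhead J le_rfl).trans hJle) (htail J le_rfl h'))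
    · linarith [hhead (k + 1) h']

/-- The partial Birkhoff sums of a character over one excursion from the ground level. -/
theorem exists_norm_birkhoffSum_le {t : ℕ → ℝ} (ht : IsPartitionSeq t)
    (hdouble : ∀ k, t (k + 1) ≤ 2 * t (k + 2)) {a : ℝ}
    (ha : a ≠ 0) : ∃ C : ℝ, 0 < C ∧ ∀ q ∈ Ioo (0 : ℝ) 1, ∀ r ≤ index t q,
      ‖birkhoffSum (halfLineMap t) (fun y : ℝ => Complex.exp (Complex.I * (a * y : ℝ))) r q‖ ≤
        C / q := by
  obtain ⟨C, hC0, hC⟩ := ht.exists_norm_sum_exp_levelPoint_le ha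
  refine ⟨1 + 2 * C, by positivity, fun q hq r hr => ?_⟩
  obtain ⟨k, hk⟩ := ht.exists_mem_cell (Ioo_subset_Ioc_self hq)
  rw [ht.index_eq hk] at hr
  have hq0 := hq.1
  rcases r with _ | r
  · rw [birkhoffSum_zero, norm_zero]; positivity
  have hq' := ht.lurothMap_mem (Ioo_subset_Ioc_self hq)
  have hsum : birkhoffSum (halfLineMap t) (fun y : ℝ => Complex.exp (Complex.I * (a * y : ℝ)))
      (r + 1) q = Complex.exp (Complex.I * (a * q : ℝ)) +
      (∑ j ∈ Finset.Ico (k + 1 - r) (k + 1),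
        Complex.exp (Complex.I * (a * levelPoint t j (lurothMap t q) : ℝ))) := by
    rw [birkhoffSum, Finset.sum_range_succ', add_comm]
    congr 1
    -- The orbit visits the levels in descending order; the sum is reversed to run upwards.
    have h1 := Finset.sum_Ico_reflect
      (fun j => Complex.exp (Complex.I * (a * levelPoint t j (lurothMap t q) : ℝ))) 0
      (m := r) (n := k) (by omega)
    rw [Nat.sub_zero, Nat.Ico_zero_eq_range] at h1
    rw [← h1]
    refine Finset.sum_congr rfl fun i hi => ?_
    rw [ht.iterate_succ_halfLineMap hq.2 hk (by have := Finset.mem_range.1 hi; omega)]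
  have hbound : ‖∑ j ∈ Finset.Ico (k + 1 - r) (k + 1),
      Complex.exp (Complex.I * (a * levelPoint t j (lurothMap t q) : ℝ))‖ ≤ C / t (k + 2) := by
    rcases Nat.eq_zero_or_pos r with rfl | hr0
    · have := ht.pos (k + 1)
      simp only [Nat.sub_zero, Finset.Ico_self, Finset.sum_empty, norm_zero]
      positivity
    · exact hC _ hq' _ _ (by omega)
  -- This uses q ≤ t_{k+1} ≤ 2 t_{k+2}.
  have h2 : C / t (k + 2) ≤ 2 * C / q := by
    rw [div_le_div_iff₀ (ht.pos (k + 1)) hq0]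
    nlinarith [hdouble k, hk.2]
  have h3 : (1 : ℝ) ≤ 1 / q := (one_le_div hq0).2 hq.2.le
  rw [hsum, add_div]
  refine (norm_add_le _ _).trans ?_
  rw [Complex.norm_exp_I_mul_ofReal]
  linarith

end IsPartitionSeq

/-! ### The Lüroth map: invariance, independence and Borel–Cantelli -/

theorem volume_preimage_sub_div (c : ℝ) {l : ℝ} (hl : l ≠ 0) (s : Set ℝ) :
    volume ((fun x => (x - c) / l) ⁻¹' s) = ENNReal.ofReal |l| * volume s := by
  have h : (fun x => (x - c) / l) ⁻¹' s = (fun x => x + -c) ⁻¹' ((fun x => x * l⁻¹) ⁻¹' s) := by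
    ext x; simp [div_eq_mul_inv, sub_eq_add_neg]
  rw [h, measure_preimage_add_right, Real.volume_preimage_mul_right (inv_ne_zero hl), inv_inv]

namespace IsPartitionSeq

theorem mem_cell_of_index_eq {t : ℕ → ℝ}
    {x : ℝ} {k : ℕ} (h : index t x = k + 1) : x ∈ cell t (k + 1) := by
  have hne : {k : ℕ | 1 ≤ k ∧ x ∈ cell t k}.Nonempty := by
    by_contra hcon
    rw [not_nonempty_iff_eq_empty] at hcon
    rw [index, hcon, Nat.sInf_empty] at h
    omega
  have := (Nat.sInf_mem hne).2
  rwa [← h]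

theorem measurable_index {t : ℕ → ℝ} (ht : IsPartitionSeq t) : Measurable (index t) := by
  have hcell : ∀ k, MeasurableSet (cell t (k + 1)) := fun k => measurableSet_Ioc
  refine measurable_to_countable' fun n => ?_
  have hsucc : ∀ k, index t ⁻¹' {k + 1} = cell t (k + 1) := fun k => by
    ext x
    exact ⟨mem_cell_of_index_eq, ht.index_eq⟩
  rcases n with _ | k
  · have h : index t ⁻¹' {0} = (⋃ k, index t ⁻¹' {k + 1})ᶜ := by
      ext x
      simp only [mem_preimage, mem_singleton_iff, mem_compl_iff, mem_iUnion, not_exists]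
      exact ⟨fun h k => by omega, fun h => by
        by_contra h0
        exact h _ (Nat.succ_pred_eq_of_ne_zero h0).symm⟩
    rw [h]
    exact (MeasurableSet.iUnion fun k => hsucc k ▸ hcell k).compl
  · exact hsucc k ▸ hcell k

theorem measurable_lurothMap {t : ℕ → ℝ} (ht : IsPartitionSeq t) : Measurable (lurothMap t) :=
  (((Measurable.of_discrete (f := t)).comp ht.measurable_index).sub measurable_id).div
    ((Measurable.of_discrete (f := len t)).comp ht.measurable_index)

/-- Every branch is affine and onto [0,1). This yields both the invariance of Lebesgue measure and
the independence of the digits. -/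
theorem volume_cell_inter_preimage {t : ℕ → ℝ} (ht : IsPartitionSeq t) (k : ℕ) (s : Set ℝ) :
    volume (cell t (k + 1) ∩ lurothMap t ⁻¹' s) =
      ENNReal.ofReal (len t (k + 1)) * volume (s ∩ Ico 0 1) := by
  have hl := ht.len_pos k
  have hvol := volume_preimage_sub_div (t (k + 1)) (neg_ne_zero.2 hl.ne') (s ∩ Ico 0 1)
  simp only [div_neg, ← neg_div, neg_sub, abs_neg, abs_of_pos hl] at hvol
  rw [← hvol]
  congr 1
  ext x
  simp only [mem_inter_iff, mem_preimage]
  constructor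
  · rintro ⟨h1, h2⟩
    have h3 := ht.lurothMap_mem (ht.cell_subset k h1)
    rw [ht.lurothMap_eq h1] at h2 h3
    exact ⟨h2, h3⟩
  · rintro ⟨h1, h2⟩
    have h3 := ht.sub_mul_len_mem_cell k h2
    rw [div_mul_cancel₀ _ hl.ne', sub_sub_cancel] at h3
    refine ⟨h3, ?_⟩
    rwa [ht.lurothMap_eq h3]

theorem iUnion_cell {t : ℕ → ℝ} (ht : IsPartitionSeq t) : ⋃ k, cell t (k + 1) = Ioc 0 1 :=
  Subset.antisymm (iUnion_subset ht.cell_subset) fun _ hx => mem_iUnion.2 (ht.exists_mem_cell hx)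

theorem volume_Ioc_inter {t : ℕ → ℝ} (ht : IsPartitionSeq t) {s : Set ℝ} (hs : MeasurableSet s) :
    volume (Ioc 0 1 ∩ s) = ∑' k, volume (cell t (k + 1) ∩ s) := by
  rw [← ht.iUnion_cell, iUnion_inter, measure_iUnion]
  · intro k l hkl
    refine disjoint_left.2 fun x hx hx' => hkl (ht.cell_unique hx.1 hx'.1)
  · exact fun k => MeasurableSet.inter measurableSet_Ioc hs

/-- The Lüroth map preserves Lebesgue measure on `[0, 1)`. -/
theorem measurePreserving_lurothMap {t : ℕ → ℝ} (ht : IsPartitionSeq t) :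
    MeasurePreserving (lurothMap t) (volume.restrict (Ico 0 1)) (volume.restrict (Ico 0 1)) := by
  refine ⟨ht.measurable_lurothMap, Measure.ext fun s hs => ?_⟩
  have hlen : ∑' k, ENNReal.ofReal (len t (k + 1)) = 1 := by
    have h := ht.volume_Ioc_inter MeasurableSet.univ
    simp only [inter_univ, Real.volume_Ioc, cell, sub_zero, ENNReal.ofReal_one] at h
    exact h.symm
  have hs' := ht.measurable_lurothMap hs
  rw [Measure.map_apply ht.measurable_lurothMap hs, Measure.restrict_congr_set Ico_ae_eq_Ioc,
    Measure.restrict_apply hs', inter_comm, ht.volume_Ioc_inter hs']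
  simp only [ht.volume_cell_inter_preimage]
  rw [ENNReal.tsum_mul_right, hlen, one_mul, ← Measure.restrict_apply hs,
    Measure.restrict_congr_set Ico_ae_eq_Ioc]

/-- Invariance pulls the null set {0} back to null sets. The point 0 lies in no cell, so orbits
reaching it must be discarded. -/
theorem ae_iterate_lurothMap_mem {t : ℕ → ℝ} (ht : IsPartitionSeq t) :
    ∀ᵐ q ∂(volume.restrict (Ico (0 : ℝ) 1)), ∀ i, (lurothMap t)^[i] q ∈ Ioo (0 : ℝ) 1 := by
  refine ae_all_iff.2 fun i =>
    (ht.measurePreserving_lurothMap.iterate i).quasiMeasurePreserving.ae ?_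
  rw [← Measure.restrict_congr_set Ioo_ae_eq_Ico]
  exact ae_restrict_mem measurableSet_Ioo

/-- By invariance the i-th iterate falls below `u i` with probability at most `u i` (or zero if that
is negative); Borel–Cantelli concludes. -/
theorem ae_eventually_le_iterate {t : ℕ → ℝ} (ht : IsPartitionSeq t) {u : ℕ → ℝ} (hu : Summable u) :
    ∀ᵐ q ∂(volume.restrict (Ico (0 : ℝ) 1)), ∀ᶠ i in atTop, u i ≤ (lurothMap t)^[i] q := by
  have h : ∀ i, volume.restrict (Ico (0 : ℝ) 1) ((lurothMap t)^[i] ⁻¹' Iio (u i)) ≤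
      ENNReal.ofReal (u i) := fun i => by
    rw [(ht.measurePreserving_lurothMap.iterate i).measure_preimage
      measurableSet_Iio.nullMeasurableSet, Measure.restrict_apply measurableSet_Iio]
    calc _ ≤ volume (Ico 0 (u i)) := measure_mono fun x hx => ⟨hx.2.1, hx.1⟩
      _ = _ := by rw [Real.volume_Ico, sub_zero]
  have hsum : ∑' i, volume.restrict (Ico (0 : ℝ) 1) ((lurothMap t)^[i] ⁻¹' Iio (u i)) ≠ ⊤ :=
    ne_top_of_le_ne_top hu.tsum_ofReal_ne_top (ENNReal.tsum_le_tsum h)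
  filter_upwards [ae_eventually_notMem hsum] with q hq
  filter_upwards [hq] with i hi
  simpa using hi

/-- The digits are independent: the first `N` of them are all at most `M` with probability
`(1 - t_{M+1})^N`. -/
theorem volume_forall_lt_iterate_le {t : ℕ → ℝ} (ht : IsPartitionSeq t) (M N : ℕ) :
    volume ({q | ∀ i < N, t (M + 1) < (lurothMap t)^[i] q} ∩ Ico 0 1) ≤
      ENNReal.ofReal (1 - t (M + 1)) ^ N := by
  induction N with
  | zero => simp
  | succ N ih =>
    set H : Set ℝ := {q | ∀ i < N, t (M + 1) < (lurothMap t)^[i] q} with hH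
    -- The first digit is at most `M`, and the image point satisfies the condition for `N`. The
    -- admissible cells have total length 1 - t_{M+1}, the factor gained at each step.
    have hsub : {q | ∀ i < N + 1, t (M + 1) < (lurothMap t)^[i] q} ∩ Ico 0 1 ⊆
        ⋃ k ∈ Finset.range M, cell t (k + 1) ∩ lurothMap t ⁻¹' H := by
      rintro q ⟨h1, h2⟩
      have h0 : t (M + 1) < q := h1 0 (by omega)
      obtain ⟨k, hk⟩ := ht.exists_mem_cell ⟨(ht.pos M).trans h0, h2.2.le⟩
      have hkM : k < M := by
        by_contra hcon
        exact absurd (hk.2.trans (ht.strictAnti.antitone (not_lt.1 hcon))) (not_le.2 h0)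
      refine mem_iUnion₂.2 ⟨k, Finset.mem_range.2 hkM, hk, fun i hi => ?_⟩
      have := h1 (i + 1) (by omega)
      rwa [Function.iterate_succ_apply] at this
    refine (measure_mono hsub).trans ((measure_biUnion_finset_le _ _).trans ?_)
    simp only [ht.volume_cell_inter_preimage]
    have hlen : ∑ k ∈ Finset.range M, len t (k + 1) = 1 - t (M + 1) := by
      simp only [len]
      rw [Finset.sum_range_sub' (fun k => t (k + 1)), zero_add, ht.one]
    rw [← Finset.sum_mul, ← ENNReal.ofReal_sum_of_nonneg fun k _ => (ht.len_pos k).le, hlen,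
      pow_succ']
    gcongr

/-- The exceptional probability is at most (1 - t)^N ≤ exp(-N t) with t = t_{M_N + 1}, which is
summable, so Borel–Cantelli applies. -/
theorem ae_eventually_exists_lt_index {t : ℕ → ℝ} (ht : IsPartitionSeq t) {M : ℕ → ℕ}
    (hM : Summable fun N : ℕ => Real.exp (-(N * t (M N + 1)))) :
    ∀ᵐ q ∂(volume.restrict (Ico (0 : ℝ) 1)),
      ∀ᶠ N in atTop, ∃ i < N, M N < index t ((lurothMap t)^[i] q) := by
  have h : ∀ N, volume.restrict (Ico (0 : ℝ) 1)
      {q | ∀ i < N, t (M N + 1) < (lurothMap t)^[i] q} ≤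
        ENNReal.ofReal (Real.exp (-(N * t (M N + 1)))) := fun N => by
    have h0 : 0 ≤ 1 - t (M N + 1) := sub_nonneg.2 (ht.le_one _)
    rw [Measure.restrict_apply' measurableSet_Ico]
    refine (ht.volume_forall_lt_iterate_le _ _).trans ?_
    rw [← ENNReal.ofReal_pow h0, ← mul_neg, Real.exp_nat_mul]
    gcongr
    linarith [Real.add_one_le_exp (-t (M N + 1))]
  have hsum : ∑' N, volume.restrict (Ico (0 : ℝ) 1)
      {q | ∀ i < N, t (M N + 1) < (lurothMap t)^[i] q} ≠ ⊤ :=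
    ne_top_of_le_ne_top hM.tsum_ofReal_ne_top (ENNReal.tsum_le_tsum h)
  filter_upwards [ae_eventually_notMem hsum, ht.ae_iterate_lurothMap_mem] with q hq hmem
  filter_upwards [hq] with N hN
  simp only [not_forall, not_lt] at hN
  obtain ⟨i, hi, hle⟩ := hN
  refine ⟨i, hi, ?_⟩
  obtain ⟨k, hk⟩ := ht.exists_mem_cell (Ioo_subset_Ioc_self (hmem i))
  rw [ht.index_eq hk]
  by_contra hcon
  have : t (M N + 1) ≤ t (k + 1 + 1) := ht.strictAnti.antitone (show k + 1 ≤ M N by omega)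
  exact absurd (hk.1.trans_le hle) (not_lt.2 this)

end IsPartitionSeq

/-! ### From excursions to Birkhoff averages and to the half-line -/

/-- The time of the `N`-th return to the ground level. -/
def returnTime (t : ℕ → ℝ) (q : ℝ) (N : ℕ) : ℕ :=
  ∑ i ∈ Finset.range N, index t ((lurothMap t)^[i] q)

theorem tendsto_birkhoffAverage_of_iterate {f : ℝ → ℝ} {g : ℝ → ℂ} (hg : ∀ y, ‖g y‖ ≤ 1) {x : ℝ}
    (k : ℕ) (h : Tendsto (fun n => birkhoffAverage ℂ f g n (f^[k] x)) atTop (𝓝 0)) :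
    Tendsto (fun n => birkhoffAverage ℂ f g n x) atTop (𝓝 0) := by
  have hbdd : Bornology.IsBounded (range g) :=
    isBounded_iff_forall_norm_le.2 ⟨1, by rintro _ ⟨y, rfl⟩; exact hg y⟩
  induction k generalizing x with
  | zero => exact h
  | succ k ih =>
    rw [Function.iterate_succ_apply] at h
    have h1 := (ih h).sub (tendsto_birkhoffAverage_apply_sub_birkhoffAverage' ℂ hbdd f x)
    simpa using h1

namespace IsPartitionSeq

theorem iterate_returnTime {t : ℕ → ℝ} (ht : IsPartitionSeq t)
    {q : ℝ} (hq : ∀ i, (lurothMap t)^[i] q ∈ Ioo (0 : ℝ) 1) (N : ℕ) :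
    (halfLineMap t)^[returnTime t q N] q = (lurothMap t)^[N] q := by
  induction N with
  | zero => rfl
  | succ N ih =>
    rw [returnTime, Finset.sum_range_succ, add_comm, Function.iterate_add_apply]
    rw [returnTime] at ih
    rw [ih, ht.iterate_index_halfLineMap (hq N), Function.iterate_succ_apply']

theorem returnTime_strictMono {t : ℕ → ℝ} (ht : IsPartitionSeq t)
    {q : ℝ} (hq : ∀ i, (lurothMap t)^[i] q ∈ Ioo (0 : ℝ) 1) :
    StrictMono (returnTime t q) := by
  refine strictMono_nat_of_lt_succ fun N => ?_
  obtain ⟨k, hk⟩ := ht.exists_mem_cell (Ioo_subset_Ioc_self (hq N))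
  rw [returnTime, returnTime, Finset.sum_range_succ, ht.index_eq hk]
  omega

/-- The orbit segment splits at the return times into `N` complete excursions and one possibly
incomplete one, each covered by `hC`. -/
theorem norm_birkhoffSum_returnTime_add_le {t : ℕ → ℝ} (ht : IsPartitionSeq t) {g : ℝ → ℂ} {C : ℝ}
    (hC : ∀ q ∈ Ioo (0 : ℝ) 1, ∀ r ≤ index t q, ‖birkhoffSum (halfLineMap t) g r q‖ ≤ C / q)
    {q : ℝ} (hq : ∀ i, (lurothMap t)^[i] q ∈ Ioo (0 : ℝ) 1) (N r : ℕ)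
    (hr : r ≤ index t ((lurothMap t)^[N] q)) :
    ‖birkhoffSum (halfLineMap t) g (returnTime t q N + r) q‖ ≤
      ∑ i ∈ Finset.range (N + 1), C / (lurothMap t)^[i] q := by
  induction N generalizing r with
  | zero =>
    simpa [returnTime] using hC q (hq 0) r hr
  | succ N ih =>
    rw [birkhoffSum_add, ht.iterate_returnTime hq, Finset.sum_range_succ]
    refine (norm_add_le _ _).trans (add_le_add ?_ (hC _ (hq _) _ hr))
    have := ih _ le_rfl
    rwa [returnTime, ← Finset.sum_range_succ] at this

/-- Birkhoff averages vanish as soon as the accumulated excursion bounds are negligible compared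
with the return times. -/
theorem tendsto_birkhoffAverage {t : ℕ → ℝ} (ht : IsPartitionSeq t) {g : ℝ → ℂ} {C : ℝ}
    (hC : ∀ q ∈ Ioo (0 : ℝ) 1, ∀ r ≤ index t q, ‖birkhoffSum (halfLineMap t) g r q‖ ≤ C / q)
    {q : ℝ} (hq : ∀ i, (lurothMap t)^[i] q ∈ Ioo (0 : ℝ) 1)
    (hlim : Tendsto (fun N : ℕ => (∑ i ∈ Finset.range (N + 1), C / (lurothMap t)^[i] q) /
      returnTime t q N) atTop (𝓝 0)) :
    Tendsto (fun n => birkhoffAverage ℂ (halfLineMap t) g n q) atTop (𝓝 0) := by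
  have hmono := ht.returnTime_strictMono hq
  rw [Metric.tendsto_atTop]
  intro ε hε
  obtain ⟨N₀, hN₀⟩ := eventually_atTop.1 (hlim.eventually (gt_mem_nhds hε))
  -- The shift by one forces `N ≥ 1` below, so that the return time in the denominator is positive.
  refine ⟨returnTime t q (N₀ + 1), fun n hn => ?_⟩
  classical
  have hex : ∃ N, n < returnTime t q (N + 1) :=
    ⟨n, (Nat.lt_succ_self n).trans_le hmono.le_apply⟩
  obtain ⟨N, hN1, hN2⟩ : ∃ N, returnTime t q N ≤ n ∧ n < returnTime t q (N + 1) := by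
    refine ⟨Nat.find hex, ?_, Nat.find_spec hex⟩
    rcases h : Nat.find hex with _ | k
    · simp [returnTime]
    · exact not_lt.1 (Nat.find_min hex (show k < Nat.find hex by omega))
  have hNN : N₀ + 1 < N + 1 := hmono.lt_iff_lt.1 (hn.trans_lt hN2)
  obtain ⟨r, rfl⟩ := Nat.exists_eq_add_of_le hN1
  have hr : r ≤ index t ((lurothMap t)^[N] q) := by
    rw [returnTime, returnTime, Finset.sum_range_succ] at hN2
    omega
  have h1 := ht.norm_birkhoffSum_returnTime_add_le hC hq N r hr
  have h2 := hN₀ N (by omega)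
  have hpos : 0 < returnTime t q N := by
    have := hmono (show 0 < N by omega)
    omega
  have hpos' : (0 : ℝ) < returnTime t q N := by exact_mod_cast hpos
  rw [div_lt_iff₀ hpos'] at h2
  have hle : (returnTime t q N : ℝ) ≤ (returnTime t q N + r : ℕ) := by exact_mod_cast hN1
  rw [dist_zero_right, birkhoffAverage, norm_smul, norm_inv, Complex.norm_natCast, inv_mul_eq_div,
    div_lt_iff₀ (hpos'.trans_le hle)]
  have := mul_le_mul_of_nonneg_left hle hε.le
  linarith

/-- A property that holds at almost every point of the ground level, and that passes from
`T^k x` to `x`, holds at almost every point of the half-line. -/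
theorem ae_Ioi_of_ae_Ico {t : ℕ → ℝ} (ht : IsPartitionSeq t)
    (hdiv : Tendsto (fun k => ∑ i ∈ Finset.range k, t (i + 1)) atTop atTop)
    {p : ℝ → Prop} (hp : ∀ x k, p ((halfLineMap t)^[k] x) → p x)
    (h : ∀ᵐ q ∂(volume.restrict (Ico (0 : ℝ) 1)), p q) :
    ∀ᵐ x ∂(volume.restrict (Ioi (0 : ℝ))), p x := by
  rw [ae_restrict_iff' measurableSet_Ico, ae_iff] at h
  rw [ae_restrict_iff' measurableSet_Ioi, ae_iff]
  set B := {q | ¬(q ∈ Ico (0 : ℝ) 1 → p q)}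
  -- The exceptional set on each level is an affine copy of the one on the ground level.
  have hnull : volume (⋃ k : ℕ, (fun x => (x - ∑ i ∈ Finset.range k, t (i + 1)) / t (k + 1)) ⁻¹' B)
      = 0 := by
    refine measure_iUnion_null fun k => ?_
    rw [volume_preimage_sub_div _ (ht.pos k).ne', h, mul_zero]
  refine measure_mono_null (fun x hx => ?_) hnull
  simp only [mem_ofPred_eq, Classical.not_imp, mem_Ioi] at hx
  obtain ⟨hx0, hx⟩ := hx
  classical
  have hex : ∃ k, x < ∑ i ∈ Finset.range (k + 1), t (i + 1) :=
    (((tendsto_add_atTop_iff_nat 1).2 hdiv).eventually (eventually_gt_atTop x)).exists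
  obtain ⟨k, hk1, hk2⟩ : ∃ k, ∑ i ∈ Finset.range k, t (i + 1) ≤ x ∧
      x < ∑ i ∈ Finset.range (k + 1), t (i + 1) := by
    refine ⟨Nat.find hex, ?_, Nat.find_spec hex⟩
    rcases h : Nat.find hex with _ | k
    · simpa using hx0.le
    · exact not_lt.1 (Nat.find_min hex (show k < Nat.find hex by omega))
  rw [Finset.sum_range_succ] at hk2
  have htk := ht.pos k
  set q := (x - ∑ i ∈ Finset.range k, t (i + 1)) / t (k + 1) with hqdef
  have hq : q ∈ Ico (0 : ℝ) 1 :=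
    ⟨div_nonneg (sub_nonneg.2 hk1) htk.le, (div_lt_one htk).2 (by linarith)⟩
  have hxq : x = levelPoint t k q := by
    rw [levelPoint, hqdef, div_mul_cancel₀ _ htk.ne', add_sub_cancel]
  refine mem_iUnion.2 ⟨k, ?_⟩
  change ¬(q ∈ Ico (0 : ℝ) 1 → p q)
  intro hpq
  refine hx (hp x k ?_)
  have := ht.iterate_halfLineMap_levelPoint 0 k hq
  rw [zero_add, ht.levelPoint_zero] at this
  rw [hxq, this]
  exact hpq hq

end IsPartitionSeq

/-! ### Power sequences and the choice of exponents -/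

theorem isPartitionSeq_powerSeq {β : ℝ} (hβ : 0 < β) : IsPartitionSeq (powerSeq β) where
  one := by simp [powerSeq]
  strictAnti k l h := Real.rpow_lt_rpow_of_neg (by positivity)
    (by exact_mod_cast Nat.succ_lt_succ h) (neg_lt_zero.2 hβ)
  tendsto := (tendsto_rpow_neg_atTop hβ).comp tendsto_natCast_atTop_atTop

theorem powerSeq_le_two_mul {β : ℝ} (hβ0 : 0 < β) (hβ1 : β ≤ 1) (k : ℕ) :
    powerSeq β (k + 1) ≤ 2 * powerSeq β (k + 2) := by
  have h1 : (2 : ℝ) ^ (-1 : ℝ) ≤ (2 : ℝ) ^ (-β) :=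
    Real.rpow_le_rpow_of_exponent_le one_le_two (by linarith)
  have h2 : (2 * ((k + 1 : ℕ) : ℝ)) ^ (-β) ≤ ((k + 2 : ℕ) : ℝ) ^ (-β) :=
    Real.rpow_le_rpow_of_nonpos (by positivity) (by push_cast; linarith [Nat.cast_nonneg (α := ℝ) k])
      (by linarith)
  rw [Real.mul_rpow two_pos.le (by positivity)] at h2
  rw [Real.rpow_neg_one] at h1
  have h3 : 0 ≤ ((k + 1 : ℕ) : ℝ) ^ (-β) := by positivity
  simp only [powerSeq]
  nlinarith

theorem tendsto_sum_powerSeq {β : ℝ} (hβ1 : β ≤ 1) :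
    Tendsto (fun k => ∑ i ∈ Finset.range k, powerSeq β (i + 1)) atTop atTop := by
  rw [← not_summable_iff_tendsto_nat_atTop_of_nonneg fun i => by unfold powerSeq; positivity]
  rw [summable_nat_add_iff 1 (f := powerSeq β)]
  exact fun h => absurd (Real.summable_nat_rpow.1 h) (by linarith)

theorem summable_exp_neg_mul_rpow {c δ : ℝ} (hc : 0 < c) (hδ : 0 < δ) :
    Summable fun N : ℕ => Real.exp (-c * (N : ℝ) ^ δ) := by
  -- With y = N^δ, the comparison function y^(-2/δ) is N^(-2).
  have h1 := (isLittleO_exp_neg_mul_rpow_atTop hc (-2 / δ)).comp_tendsto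
    ((tendsto_rpow_atTop hδ).comp tendsto_natCast_atTop_atTop)
  refine summable_of_isBigO_nat (Real.summable_nat_rpow.2 (by norm_num : (-2 : ℝ) < -1)) ?_
  refine h1.isBigO.congr_right fun N => ?_
  simp only [Function.comp_apply]
  rw [← Real.rpow_mul (Nat.cast_nonneg N), mul_div_cancel₀ _ hδ.ne']

theorem summable_exp_neg_mul_powerSeq {β γ : ℝ} (hβ : 0 < β) (hγ : 0 < γ) (hβγ : β * γ < 1) :
    Summable fun N : ℕ => Real.exp (-(N * powerSeq β (⌈(N : ℝ) ^ γ⌉₊ + 1))) := by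
  -- The 3 comes from ⌈N^γ⌉ + 1 ≤ 3 N^γ for N ≥ 1.
  have hc : (0 : ℝ) < 3 ^ (-β) := by positivity
  refine Summable.of_nonneg_of_le (fun N => (Real.exp_pos _).le) (fun N => ?_)
    (summable_exp_neg_mul_rpow hc (sub_pos.2 hβγ))
  rcases Nat.eq_zero_or_pos N with rfl | hN
  · simp [Real.zero_rpow (sub_pos.2 hβγ).ne']
  rw [Real.exp_le_exp, neg_mul, neg_le_neg_iff]
  have hN' : (1 : ℝ) ≤ N := by exact_mod_cast hN
  have hN0 : (0 : ℝ) < N := by linarith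
  have h1 : (1 : ℝ) ≤ (N : ℝ) ^ γ := Real.one_le_rpow hN' hγ.le
  have h2 : ((⌈(N : ℝ) ^ γ⌉₊ + 1 : ℕ) : ℝ) ≤ 3 * (N : ℝ) ^ γ := by
    have := (Nat.ceil_lt_add_one (zero_le_one.trans h1)).le
    push_cast
    linarith
  have h3 : (3 * (N : ℝ) ^ γ) ^ (-β) ≤ powerSeq β (⌈(N : ℝ) ^ γ⌉₊ + 1) :=
    Real.rpow_le_rpow_of_nonpos (by positivity) h2 (by linarith)
  calc (3 : ℝ) ^ (-β) * (N : ℝ) ^ (1 - β * γ) = N * (3 * (N : ℝ) ^ γ) ^ (-β) := by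
        rw [Real.mul_rpow (by norm_num) (by positivity), ← Real.rpow_mul hN0.le, sub_eq_add_neg,
          Real.rpow_add hN0, Real.rpow_one, mul_neg, mul_comm γ β]
        ring
    _ ≤ _ := by gcongr

/-- If `u_i ≥ (i + 1)^{-p}` eventually and `N^γ ≤ v_N` eventually, where `p + 1 < γ`, then
`∑_{i ≤ N} C / u_i` is negligible compared with `v_N`. -/
theorem tendsto_sum_div_div {u v : ℕ → ℝ} {C p γ : ℝ} (hC : 0 < C) (hp : 0 < p) (hpγ : p + 1 < γ)
    (hu0 : ∀ i, 0 < u i) (hu : ∀ᶠ i : ℕ in atTop, ((i + 1 : ℕ) : ℝ) ^ (-p) ≤ u i)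
    (hv : ∀ᶠ N : ℕ in atTop, (N : ℝ) ^ γ ≤ v N) :
    Tendsto (fun N : ℕ => (∑ i ∈ Finset.range (N + 1), C / u i) / v N) atTop (𝓝 0) := by
  -- An eventual bound on a sequence becomes a bound for all indices at the cost of a constant `K`.
  have hbdd : IsBoundedUnder (· ≤ ·) atTop fun i : ℕ => ((i + 1 : ℕ) : ℝ) ^ (-p) / u i :=
    ⟨1, eventually_map.2 (hu.mono fun i hi => (div_le_one (hu0 i)).2 hi)⟩
  obtain ⟨K, hK⟩ := hbdd.bddAbove_range
  have hK' : ∀ i : ℕ, 1 / u i ≤ K * ((i + 1 : ℕ) : ℝ) ^ p := fun i => by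
    have h1 : ((i + 1 : ℕ) : ℝ) ^ (-p) / u i ≤ K := hK ⟨i, rfl⟩
    have h2 : (0 : ℝ) < ((i + 1 : ℕ) : ℝ) ^ p := by positivity
    rw [Real.rpow_neg (by positivity), inv_eq_one_div, div_div, mul_comm, ← div_div,
      div_le_iff₀ h2] at h1
    exact h1
  have hK0 : 0 ≤ K := by
    have h1 : ((0 + 1 : ℕ) : ℝ) ^ (-p) / u 0 ≤ K := hK ⟨0, rfl⟩
    have := hu0 0
    exact le_trans (by positivity) h1
  have hsum : ∀ N : ℕ, ∑ i ∈ Finset.range (N + 1), C / u i ≤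
      C * K * ((N + 1 : ℕ) : ℝ) ^ (p + 1) := fun N => by
    calc _ ≤ ∑ i ∈ Finset.range (N + 1), C * K * ((N + 1 : ℕ) : ℝ) ^ p := by
          refine Finset.sum_le_sum fun i hi => ?_
          have h1 : ((i + 1 : ℕ) : ℝ) ≤ (N + 1 : ℕ) := by
            exact_mod_cast Nat.succ_le_of_lt (Finset.mem_range.1 hi)
          calc C / u i = C * (1 / u i) := by ring
            _ ≤ C * (K * ((i + 1 : ℕ) : ℝ) ^ p) := mul_le_mul_of_nonneg_left (hK' i) hC.le
            _ ≤ C * (K * ((N + 1 : ℕ) : ℝ) ^ p) := by gcongr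
            _ = _ := by ring
      _ = _ := by
          rw [Finset.sum_const, Finset.card_range, nsmul_eq_mul, Real.rpow_add (by positivity),
            Real.rpow_one]
          ring
  have hlim : Tendsto (fun N : ℕ => C * K * 2 ^ (p + 1) * (N : ℝ) ^ (-(γ - (p + 1)))) atTop
      (𝓝 0) := by
    have := ((tendsto_rpow_neg_atTop (sub_pos.2 hpγ)).comp tendsto_natCast_atTop_atTop).const_mul
      (C * K * 2 ^ (p + 1))
    simpa using this
  refine squeeze_zero' ?_ ?_ hlim
  · filter_upwards [hv] with N hN
    have : 0 ≤ v N := le_trans (by positivity) hN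
    exact div_nonneg (Finset.sum_nonneg fun i _ => (div_pos hC (hu0 i)).le) this
  · filter_upwards [hv, eventually_ge_atTop 1] with N hN hN1
    have hN1' : (1 : ℝ) ≤ N := by exact_mod_cast hN1
    have hN0 : (0 : ℝ) < N := by linarith
    calc _ ≤ C * K * (2 * (N : ℝ)) ^ (p + 1) / (N : ℝ) ^ γ := by
          have h1 : ((N + 1 : ℕ) : ℝ) ≤ 2 * N := by push_cast; linarith
          have h2 := hsum N
          have h3 : C * K * ((N + 1 : ℕ) : ℝ) ^ (p + 1) ≤ C * K * (2 * (N : ℝ)) ^ (p + 1) := by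
            gcongr
          have h4 := h2.trans h3
          gcongr
      _ = _ := by
          rw [Real.mul_rpow two_pos.le hN0.le, neg_sub, Real.rpow_sub hN0]
          ring

theorem ae_Ico_tendsto_birkhoffAverage {β : ℝ} (hβ : β ∈ Ioo (0 : ℝ) (1 / 2)) {a : ℝ}
    (ha : a ≠ 0) : ∀ᵐ q ∂(volume.restrict (Ico (0 : ℝ) 1)),
      Tendsto (fun n => birkhoffAverage ℂ (halfLineMap (powerSeq β))
        (fun y : ℝ => Complex.exp (Complex.I * (a * y : ℝ))) n q) atTop (𝓝 0) := by
  have ht := isPartitionSeq_powerSeq hβ.1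
  obtain ⟨C, hC0, hC⟩ := ht.exists_norm_birkhoffSum_le
    (powerSeq_le_two_mul hβ.1 (by linarith [hβ.2])) ha
  -- This is where β < 1/2 is essential: γ < 1/β is needed for large digits, and γ > 2 leaves room
  -- for p > 1 (summability) with p + 1 < γ.
  obtain ⟨γ, hγ2, hγ⟩ : ∃ γ, 2 < γ ∧ γ < 1 / β :=
    exists_between ((lt_div_iff₀ hβ.1).2 (by linarith [hβ.2]))
  obtain ⟨p, hp1, hp⟩ : ∃ p, 1 < p ∧ p < γ - 1 := exists_between (by linarith)
  have hβγ : β * γ < 1 := by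
    rw [lt_div_iff₀ hβ.1] at hγ
    linarith
  have hsum : Summable fun i : ℕ => ((i + 1 : ℕ) : ℝ) ^ (-p) :=
    (summable_nat_add_iff 1).2 (Real.summable_nat_rpow.2 (neg_lt_neg hp1))
  filter_upwards [ht.ae_iterate_lurothMap_mem, ht.ae_eventually_le_iterate hsum,
    ht.ae_eventually_exists_lt_index (summable_exp_neg_mul_powerSeq hβ.1 (by linarith) hβγ)]
    with q hmem hlow hindex
  refine ht.tendsto_birkhoffAverage hC hmem (tendsto_sum_div_div hC0 (by linarith)
    (lt_sub_iff_add_lt.1 hp) (fun i => (hmem i).1) hlow ?_)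
  filter_upwards [hindex] with N hN
  obtain ⟨i, hi, hlt⟩ := hN
  -- A single large digit already makes the return time large.
  have h1 : index (powerSeq β) ((lurothMap (powerSeq β))^[i] q) ≤ returnTime (powerSeq β) q N :=
    Finset.single_le_sum (f := fun i => index (powerSeq β) ((lurothMap (powerSeq β))^[i] q))
      (fun _ _ => Nat.zero_le _) (Finset.mem_range.2 hi)
  refine (Nat.le_ceil _).trans ?_
  exact_mod_cast (hlt.le.trans h1)

end

end AlphaFarey

theorem proposition3 (β : ℝ) (hβ : β ∈ Ioo (0 : ℝ) (1 / 2)) (ω : ℝ) (hω : ω ≠ 0) :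
    ∀ᵐ x ∂(volume.restrict (Ioi (0 : ℝ))),
      Tendsto
        (fun n : ℕ =>
          birkhoffAverage ℂ (AlphaFarey.T β)
            (fun y : ℝ => Complex.exp (2 * Real.pi * Complex.I * ω * y)) n x)
        atTop (𝓝 0) := by
  have hf : (fun y : ℝ => Complex.exp (2 * Real.pi * Complex.I * ω * y)) =
      fun y : ℝ => Complex.exp (Complex.I * (2 * Real.pi * ω * y : ℝ)) := by
    funext y
    congr 1
    push_cast
    ring
  rw [hf]
  have ha : 2 * Real.pi * ω ≠ 0 := mul_ne_zero Real.two_pi_pos.ne' hω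
  refine (AlphaFarey.isPartitionSeq_powerSeq hβ.1).ae_Ioi_of_ae_Ico
    (AlphaFarey.tendsto_sum_powerSeq (by linarith [hβ.2]))
    (fun x k => AlphaFarey.tendsto_birkhoffAverage_of_iterate
      (fun y => (Complex.norm_exp_I_mul_ofReal _).le) k)
    (AlphaFarey.ae_Ico_tendsto_birkhoffAverage hβ ha)
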